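/- Let $(R,\mathfrak m)$ be a commutative Noetherian local ring and let $C$ be a semidualizing $R$-module, i.e. a finitely generated $R$-module such that the homothety map $R\to \operatorname{Hom}_R(C,C)$ is an isomorphism and $\operatorname{Ext}^i_R(C,C)=0$ for all $i>0$. Let $M$ be a non-zero (not necessarily finitely generated) $R$-module. Then $$\text{(i)}\quad \operatorname{depth} R\le \operatorname{depth}_R M+C\text{-}\mathrm{pd}_R(M),\qquad \text{(ii)}\quad \operatorname{depth} R\le \operatorname{width}_R M+C\text{-}\mathrm{id}_R(M).$$ Here $\operatorname{depth}_R M=\inf\{i\ge 0\mid \operatorname{Ext}^i_R(R/\mathfrak m,M)\ne 0\}$, $\operatorname{depth} R=\operatorname{depth}_R R$, and $\operatorname{width}_R M=\inf\{i\ge 0\mid \operatorname{Tor}_i^R(R/\mathfrak m,M)\ne 0\}$. The $C$-projective dimension $C\text{-}\mathrm{pd}_R(M)$ is the infimum of $\sup\{n\ge 0\mid X_n\ne 0\}$ over all complexes $X=(\cdots\to X_1\to X_0\to 0)$ with $H_0(X)\cong M$ and $H_n(X)=0$ for $n\ge 1$, in which every $X_n$ is isomorphic to $C\otimes_R P$ for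 some projective $R$-module $P$. Dually, the $C$-injective dimension $C\text{-}\mathrm{id}_R(M)$ is the infimum of $\sup\{n\ge 0\mid X^n\ne 0\}$ over all complexes $X=(0\to X^0\to X^1\to\cdots)$ with $H^0(X)\cong M$ and $H^n(X)=0$ for $n\ge 1$, in which every $X^n$ is isomorphic to $\operatorname{Hom}_R(C,I)$ for some injective $R$-module $I$. All these quantities may be $\infty$, and $\inf\emptyset=\infty$. -/

import Mathlib

open CategoryTheory TensorProduct

universe u

/-- A finitely generated module `C` over a commutative ring `R` is semidualizing if the homothety
map `R → Hom_R(C, C)` is an isomorphism and `Ext^i_R(C, C) = 0` for all `i > 0`. -/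
structure IsSemidualizing (R : Type u) [CommRing R] (C : Type u) [AddCommGroup C] [Module R C] :
    Prop where
  finite : Module.Finite R C
  homothety_bijective : Function.Bijective (LinearMap.lsmul R C : R →ₗ[R] (C →ₗ[R] C))
  ext_eq_zero : ∀ i : ℕ, 0 < i →
    Subsingleton (Abelian.Ext (ModuleCat.of R C) (ModuleCat.of R C) i)

/-- The class `𝒫_C` of `C`-projective modules: those isomorphic to `C ⊗ P` with `P` projective. -/
def CProjective (R : Type u) [CommRing R] (C : Type u) [AddCommGroup C] [Module R C] :
    ObjectProperty (ModuleCat.{u} R) :=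
  fun X => ∃ P : ModuleCat.{u} R, Module.Projective R P ∧ Nonempty (X ≃ₗ[R] C ⊗[R] P)

/-- The class `ℐ_C` of `C`-injective modules: those isomorphic to `Hom(C, I)` with `I`
injective. -/
def CInjective (R : Type u) [CommRing R] (C : Type u) [AddCommGroup C] [Module R C] :
    ObjectProperty (ModuleCat.{u} R) :=
  fun X => ∃ I : ModuleCat.{u} R, Module.Injective R I ∧ Nonempty (X ≃ₗ[R] (C →ₗ[R] I))

/-- `X` is a resolution of `M` by modules from the class `𝒳`: a complex
`⋯ → X₁ → X₀ → 0` of modules in `𝒳` with `H₀(X) ≅ M` and `H_n(X) = 0` for `n ≥ 1`. -/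
structure IsClassResolution {R : Type u} [CommRing R] (𝒳 : ObjectProperty (ModuleCat.{u} R))
    (M : ModuleCat.{u} R) (X : ChainComplex (ModuleCat.{u} R) ℕ) : Prop where
  mem : ∀ n : ℕ, 𝒳 (X.X n)
  homology_zero : Nonempty (X.homology 0 ≅ M)
  homology_pos : ∀ n : ℕ, 1 ≤ n → Limits.IsZero (X.homology n)

/-- `X` is a coresolution of `M` by modules from the class `𝒳`: a complex
`0 → X⁰ → X¹ → ⋯` of modules in `𝒳` with `H⁰(X) ≅ M` and `Hⁿ(X) = 0` for `n ≥ 1`. -/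
structure IsClassCoresolution {R : Type u} [CommRing R] (𝒳 : ObjectProperty (ModuleCat.{u} R))
    (M : ModuleCat.{u} R) (X : CochainComplex (ModuleCat.{u} R) ℕ) : Prop where
  mem : ∀ n : ℕ, 𝒳 (X.X n)
  homology_zero : Nonempty (X.homology 0 ≅ M)
  homology_pos : ∀ n : ℕ, 1 ≤ n → Limits.IsZero (X.homology n)

/-- The `𝒳`-projective dimension: the infimum over all `𝒳`-resolutions `X` of `M` of
`sup {n | X_n ≠ 0}`. The values are `-∞` (for `M = 0`), natural numbers, and `∞` (in particular
if there is no resolution). -/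
noncomputable def classPd {R : Type u} [CommRing R] (𝒳 : ObjectProperty (ModuleCat.{u} R))
    (M : ModuleCat.{u} R) : WithBot ℕ∞ :=
  ⨅ (X : ChainComplex (ModuleCat.{u} R) ℕ) (_ : IsClassResolution 𝒳 M X),
    ⨆ (n : ℕ) (_ : Nontrivial (X.X n)), (n : WithBot ℕ∞)

/-- The `𝒳`-injective dimension: the infimum over all `𝒳`-coresolutions `X` of `M` of
`sup {n | Xⁿ ≠ 0}`. -/
noncomputable def classId {R : Type u} [CommRing R] (𝒳 : ObjectProperty (ModuleCat.{u} R))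
    (M : ModuleCat.{u} R) : WithBot ℕ∞ :=
  ⨅ (X : CochainComplex (ModuleCat.{u} R) ℕ) (_ : IsClassCoresolution 𝒳 M X),
    ⨆ (n : ℕ) (_ : Nontrivial (X.X n)), (n : WithBot ℕ∞)

/-- `C-pd_R(M)`, the projective dimension of `M` with respect to the class `𝒫_C`. -/
noncomputable def cPd (R : Type u) [CommRing R] (C M : Type u) [AddCommGroup C] [Module R C]
    [AddCommGroup M] [Module R M] : WithBot ℕ∞ :=
  classPd (CProjective R C) (ModuleCat.of R M)

/-- `C-id_R(M)`, the injective dimension of `M` with respect to the class `ℐ_C`. -/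
noncomputable def cId (R : Type u) [CommRing R] (C M : Type u) [AddCommGroup C] [Module R C]
    [AddCommGroup M] [Module R M] : WithBot ℕ∞ :=
  classId (CInjective R C) (ModuleCat.of R M)

/-- `depth_R(M) = inf {i ≥ 0 | Ext^i_R(R/𝔪, M) ≠ 0}`, for an arbitrary module `M` over a local
ring `(R, 𝔪)`; it is `∞` if all these `Ext` modules vanish. -/
noncomputable def moduleDepth (R : Type u) [CommRing R] [IsLocalRing R] (M : Type u)
    [AddCommGroup M] [Module R M] : ℕ∞ :=
  ⨅ (i : ℕ) (_ : Nontrivial (Abelian.Ext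
    (ModuleCat.of R (R ⧸ IsLocalRing.maximalIdeal R)) (ModuleCat.of R M) i)), (i : ℕ∞)

/-- `width_R(M) = inf {i ≥ 0 | Tor_i^R(R/𝔪, M) ≠ 0}`, for an arbitrary module `M` over a local
ring `(R, 𝔪)`; it is `∞` if all these `Tor` modules vanish. (`Tor'` is `Tor` computed from a
projective resolution of the first argument, here `R/𝔪`.) -/
noncomputable def moduleWidth (R : Type u) [CommRing R] [IsLocalRing R] (M : Type u)
    [AddCommGroup M] [Module R M] : ℕ∞ :=
  ⨅ (i : ℕ) (_ : ¬ Limits.IsZero (((Tor' (ModuleCat.{u} R) i).obj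
    (ModuleCat.of R (R ⧸ IsLocalRing.maximalIdeal R))).obj (ModuleCat.of R M))), (i : ℕ∞)

/-! Let `k = R/𝔪` and suppose `Ext^i(k, R) = 0` for `i < t`. Since `R ≅ Hom(C, C)` and the higher
`Ext^i(C, C)` vanish, `Ext^i(k, C) = 0` for `i < t` (`ext_residue_subsingleton_of_hom`). This
vanishing passes to `Ext^i(k, C ⊗ P)` for flat `P` (`ext_subsingleton_tensor_flat`) and to `Tor_i(k,
Hom(C, I))` for injective `I` (`isZero_tor_hom_injective`). Dimension shifting along a
(co)resolution then loses one degree per step, which gives both inequalities.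

All three transfers are inductions on `t` along a regular sequence: an element `x` that kills the
first argument and is regular on the finitely generated module `N` reduces the claim from `N` to
`N/xN`. Only `C` and its quotients are cut down, so no finiteness of `P`, `I` or `M` is needed. -/

/-- `Hom(C, -)` is left exact. -/
lemma LinearMap.exact_compRight_of_exact_of_injective {R C A B D : Type*} [CommRing R]
    [AddCommGroup C] [Module R C] [AddCommGroup A] [Module R A] [AddCommGroup B] [Module R B]
    [AddCommGroup D] [Module R D] {f : A →ₗ[R] B} {g : B →ₗ[R] D} (hf : Function.Injective f)
    (hfg : Function.Exact f g) :
    Function.Exact (f.compRight R : (C →ₗ[R] A) → (C →ₗ[R] B))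
      (g.compRight R : (C →ₗ[R] B) → (C →ₗ[R] D)) := by
  intro φ
  constructor
  · intro h
    have hφ : ∀ c, φ c ∈ LinearMap.range f := fun c ↦ (hfg _).1 (LinearMap.congr_fun h c)
    refine ⟨(LinearEquiv.ofInjective f hf).symm.toLinearMap ∘ₗ LinearMap.codRestrict _ φ hφ, ?_⟩
    ext c
    exact LinearEquiv.ofInjective_symm_apply (h := hf) f ⟨φ c, hφ c⟩
  · rintro ⟨ψ, rfl⟩
    ext c
    exact (hfg _).2 ⟨ψ c, rfl⟩

/-! ### `Ext` and regular elements -/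

section ExtVanishing

open Abelian

variable {R : Type u} [CommRing R]

/-- The short complex attached to an injection, exact in the middle, followed by a surjection. -/
lemma ModuleCat.shortExact_of_linearMap {A B D : Type u} [AddCommGroup A] [Module R A]
    [AddCommGroup B] [Module R B] [AddCommGroup D] [Module R D] {f : A →ₗ[R] B} {g : B →ₗ[R] D}
    (hf : Function.Injective f) (hfg : Function.Exact f g) (hg : Function.Surjective g) :
    (ModuleCat.shortComplexOfCompEqZero f g hfg.linearMap_comp_eq_zero).ShortExact where
  exact := ModuleCat.shortComplex_exact _ hfg
  mono_f := (ModuleCat.mono_iff_injective _).2 hf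
  epi_g := (ModuleCat.epi_iff_surjective _).2 hg

lemma CategoryTheory.Abelian.Ext.subsingleton_of_iso {K A B : ModuleCat.{u} R} (e : A ≅ B) {i : ℕ}
    (h : Subsingleton (Ext K A i)) : Subsingleton (Ext K B i) := by
  refine subsingleton_of_forall_eq 0 fun y ↦ ?_
  have : y = (y.comp (Ext.mk₀ e.inv) (add_zero i)).comp (Ext.mk₀ e.hom) (add_zero i) := by
    simp
  rw [this, Subsingleton.elim (y.comp (Ext.mk₀ e.inv) (add_zero i)) 0, Ext.zero_comp]

lemma CategoryTheory.ShortComplex.ShortExact.subsingleton_ext_X₃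
    {S : ShortComplex (ModuleCat.{u} R)} (hS : S.ShortExact) {K : ModuleCat.{u} R} {i : ℕ}
    (h₂ : Subsingleton (Ext K S.X₂ i)) (h₁ : Subsingleton (Ext K S.X₁ (i + 1))) :
    Subsingleton (Ext K S.X₃ i) := by
  refine subsingleton_of_forall_eq 0 fun y ↦ ?_
  obtain ⟨z, rfl⟩ := Ext.covariant_sequence_exact₃ K hS y rfl (Subsingleton.elim _ _)
  rw [Subsingleton.elim z 0, Ext.zero_comp]

lemma subsingleton_linearMap_of_ext_zero {K N : Type u} [AddCommGroup K] [Module R K]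
    [AddCommGroup N] [Module R N]
    (h : Subsingleton (Ext (ModuleCat.of R K) (ModuleCat.of R N) 0)) :
    Subsingleton (K →ₗ[R] N) :=
  ((Ext.homEquiv₀ (X := ModuleCat.of R K) (Y := ModuleCat.of R N)).trans
    ModuleCat.homEquiv).symm.subsingleton

variable {K A B : Type u} [AddCommGroup K] [Module R K] [AddCommGroup A] [Module R A]
  [AddCommGroup B] [Module R B] {x : R} {g : A →ₗ[R] B}

/-- Multiplication by an element of the annihilator of the first argument is zero on `Ext`. -/
lemma ext_comp_smul_eq_zero (hx : x ∈ Module.annihilator R K) {i : ℕ}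
    (y : Ext (ModuleCat.of R K) (ModuleCat.of R A) i) :
    y.comp (Ext.mk₀ (ModuleCat.ofHom (LinearMap.lsmul R A x))) (add_zero i) = 0 := by
  have h0 : x • 𝟙 (ModuleCat.of R K) = 0 := by
    ext k
    exact Module.mem_annihilator.1 hx k
  have h1 : ModuleCat.ofHom (LinearMap.lsmul R A x) = x • 𝟙 (ModuleCat.of R A) := rfl
  rw [h1, ← Ext.smul_eq_comp_mk₀, ← Ext.mk₀_id_comp y, ← Ext.smul_comp, ← Ext.mk₀_smul, h0,
    Ext.mk₀_zero, Ext.zero_comp]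

/-- As `x` acts by zero on `Ext(K, A)`, the long exact sequence makes the connecting maps `Ext^i(K,
B) → Ext^(i+1)(K, A)` surjective, and `Hom(K, A)` vanishes because `x` is injective on `A`. -/
lemma ext_subsingleton_of_regular_quotient (hx : x ∈ Module.annihilator R K)
    (hreg : IsSMulRegular A x) (hex : Function.Exact (LinearMap.lsmul R A x) g)
    (hg : Function.Surjective g) {t : ℕ}
    (h : ∀ i < t, Subsingleton (Ext (ModuleCat.of R K) (ModuleCat.of R B) i)) :
    ∀ i < t + 1, Subsingleton (Ext (ModuleCat.of R K) (ModuleCat.of R A) i) := by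
  have hS := ModuleCat.shortExact_of_linearMap (f := LinearMap.lsmul R A x) hreg hex hg
  intro i hi
  refine subsingleton_of_forall_eq 0 fun y ↦ ?_
  cases i with
  | zero =>
    have := hS.mono_f
    exact Ext.postcomp_mk₀_injective_of_mono _ (ModuleCat.ofHom (LinearMap.lsmul R A x))
      ((ext_comp_smul_eq_zero hx y).trans (Ext.zero_comp _ _ _ _ (add_zero 0)).symm)
  | succ i =>
    obtain ⟨z, rfl⟩ := Ext.covariant_sequence_exact₁ (ModuleCat.of R K) hS y
      (ext_comp_smul_eq_zero hx y) rfl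
    have := h i (by omega)
    rw [show z = 0 from Subsingleton.elim (α := Ext (ModuleCat.of R K) (ModuleCat.of R B) i) _ _,
      Ext.zero_comp]

lemma ext_regular_quotient_subsingleton
    (hreg : IsSMulRegular A x) (hex : Function.Exact (LinearMap.lsmul R A x) g)
    (hg : Function.Surjective g) {t : ℕ}
    (h : ∀ i < t + 1, Subsingleton (Ext (ModuleCat.of R K) (ModuleCat.of R A) i)) :
    ∀ i < t, Subsingleton (Ext (ModuleCat.of R K) (ModuleCat.of R B) i) := fun i hi ↦
  (ModuleCat.shortExact_of_linearMap (f := LinearMap.lsmul R A x)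
    hreg hex hg).subsingleton_ext_X₃ (h i (by omega)) (h (i + 1) (by omega))

/-- If `Ext¹(C, A) = 0`, then `Hom(C, -)` preserves surjectivity of `A → B` with kernel `A`. -/
lemma surjective_compRight_of_ext_one (C : Type u) [AddCommGroup C] [Module R C]
    (hC : Subsingleton (Ext (ModuleCat.of R C) (ModuleCat.of R A) 1))
    (hreg : IsSMulRegular A x) (hex : Function.Exact (LinearMap.lsmul R A x) g)
    (hg : Function.Surjective g) :
    Function.Surjective (g.compRight R : (C →ₗ[R] A) → (C →ₗ[R] B)) := by
  intro φ
  have hS := ModuleCat.shortExact_of_linearMap (f := LinearMap.lsmul R A x) hreg hex hg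
  obtain ⟨z, hz⟩ := Ext.covariant_sequence_exact₃ (ModuleCat.of R C) hS
    (Ext.mk₀ (ModuleCat.ofHom φ)) (zero_add 1)
    (Subsingleton.elim (α := Ext (ModuleCat.of R C) (ModuleCat.of R A) 1) _ _)
  obtain ⟨ψ, rfl⟩ := (Ext.mk₀_bijective _ _).2 z
  rw [Ext.mk₀_comp_mk₀] at hz
  have := (Ext.mk₀_bijective _ _).1 hz
  exact ⟨ψ.hom, congrArg ModuleCat.Hom.hom this⟩

end ExtVanishing

/-! ### Depth of `C` and of `C ⊗ P` -/

section DepthSemidualizing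

open Abelian IsLocalRing

variable {R : Type u} [CommRing R] [IsNoetherianRing R]

lemma exists_isSMulRegular_of_ext_zero {K N : Type u} [AddCommGroup K] [Module R K]
    [AddCommGroup N] [Module R N] [Module.Finite R K] [Module.Finite R N]
    (h : Subsingleton (Ext (ModuleCat.of R K) (ModuleCat.of R N) 0)) :
    ∃ x ∈ Module.annihilator R K, IsSMulRegular N x :=
  IsSMulRegular.subsingleton_linearMap_iff.1 (subsingleton_linearMap_of_ext_zero h)

variable [IsLocalRing R]

omit [IsNoetherianRing R] in
lemma annihilator_quotient_maximalIdeal :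
    Module.annihilator R (R ⧸ maximalIdeal R) = maximalIdeal R := Ideal.annihilator_quotient

/-- A finitely generated nonzero module over a local ring detects vanishing of the socle. -/
lemma subsingleton_hom_residue_of_hom_hom (C N : Type u) [AddCommGroup C] [Module R C]
    [AddCommGroup N] [Module R N] [Module.Finite R C] [Nontrivial C] [Module.Finite R N]
    (h : Subsingleton ((R ⧸ maximalIdeal R) →ₗ[R] (C →ₗ[R] N))) :
    Subsingleton ((R ⧸ maximalIdeal R) →ₗ[R] N) := by
  -- Swapping arguments yields `r ∈ Ann C` regular on `Hom(k, N)`. But `C ≠ 0` forces `r ∈ 𝔪`, which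
  -- kills `Hom(k, N)`.
  have h' : Subsingleton (C →ₗ[R] ((R ⧸ maximalIdeal R) →ₗ[R] N)) :=
    (Function.LeftInverse.injective (g := LinearMap.flip) (f := LinearMap.flip)
      fun _ ↦ rfl).subsingleton
  obtain ⟨r, hr, hreg⟩ := IsSMulRegular.subsingleton_linearMap_iff.1 h'
  have hrm : r ∈ maximalIdeal R := by
    refine le_maximalIdeal ?_ hr
    rw [Ne, Module.annihilator_eq_top_iff]
    exact not_subsingleton C
  refine subsingleton_of_forall_eq 0 fun f ↦ hreg ?_
  ext
  simp only [smul_zero]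
  have : r • (1 : R ⧸ maximalIdeal R) = 0 :=
    Module.mem_annihilator.1 (annihilator_quotient_maximalIdeal.ge hrm) 1
  simp [← map_smul, this]

/-- If `Ext^i(C, N) = 0` for all `i > 0`, then the depth of `Hom(C, N)` is at most that of `N`. -/
theorem ext_residue_subsingleton_of_hom (C : Type u) [AddCommGroup C] [Module R C]
    [Module.Finite R C] [Nontrivial C] (t : ℕ) : ∀ (N : Type u) [AddCommGroup N] [Module R N]
    [Module.Finite R N],
    (∀ i : ℕ, 0 < i → Subsingleton (Ext (ModuleCat.of R C) (ModuleCat.of R N) i)) →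
    (∀ i < t, Subsingleton (Ext (ModuleCat.of R (R ⧸ maximalIdeal R))
      (ModuleCat.of R (C →ₗ[R] N)) i)) →
    ∀ i < t, Subsingleton (Ext (ModuleCat.of R (R ⧸ maximalIdeal R)) (ModuleCat.of R N) i) := by
  induction t with
  | zero => intros; omega
  | succ t ih =>
    intro N _ _ _ hCN hdepth
    obtain ⟨x, hx, hreg⟩ := IsSMulRegular.subsingleton_linearMap_iff.1
      (subsingleton_hom_residue_of_hom_hom C N
        (subsingleton_linearMap_of_ext_zero (hdepth 0 t.succ_pos)))
    have hex := LinearMap.exact_lsmul_mkQ_smul_top N x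
    have hsurj := Submodule.mkQ_surjective (Submodule.map (LinearMap.lsmul R N x) ⊤)
    have hS := ModuleCat.shortExact_of_linearMap (f := LinearMap.lsmul R N x) hreg hex hsurj
    -- `N/xN` inherits the vanishing of `Ext^i(C, -)`, and `Ext^1(C, N) = 0` identifies `Hom(C,
    -- N/xN)` with `Hom(C, N)/x Hom(C, N)`.
    refine ext_subsingleton_of_regular_quotient hx hreg hex hsurj (ih _ (fun i hi ↦
      hS.subsingleton_ext_X₃ (hCN i hi) (hCN (i + 1) i.succ_pos)) ?_)
    refine ext_regular_quotient_subsingleton (x := x) ?_ ?_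
      (surjective_compRight_of_ext_one C (hCN 1 one_pos) hreg hex hsurj) hdepth
    · intro φ ψ h
      ext c
      exact hreg (LinearMap.congr_fun h c)
    · exact LinearMap.exact_compRight_of_exact_of_injective
        (f := LinearMap.lsmul R N x) hreg hex

theorem IsSemidualizing.ext_residue_subsingleton {C : Type u} [AddCommGroup C] [Module R C]
    (hC : IsSemidualizing R C) {t : ℕ}
    (h : ∀ i < t, Subsingleton (Ext (ModuleCat.of R (R ⧸ maximalIdeal R))
      (ModuleCat.of R R) i)) :
    ∀ i < t, Subsingleton (Ext (ModuleCat.of R (R ⧸ maximalIdeal R)) (ModuleCat.of R C) i) := by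
  have := hC.finite
  have : Nontrivial C := by
    by_contra hn
    have := not_nontrivial_iff_subsingleton.1 hn
    exact not_subsingleton R hC.homothety_bijective.1.subsingleton
  exact ext_residue_subsingleton_of_hom C t C hC.ext_eq_zero fun i hi ↦
    Ext.subsingleton_of_iso (LinearEquiv.ofBijective _ hC.homothety_bijective).toModuleIso (h i hi)

omit [IsLocalRing R] in
/-- Tensoring a finitely generated module with a flat module does not decrease the depth. -/
theorem ext_subsingleton_tensor_flat (K P : Type u) [AddCommGroup K] [Module R K]
    [Module.Finite R K] [AddCommGroup P] [Module R P] [Module.Flat R P] (t : ℕ) :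
    ∀ (N : Type u) [AddCommGroup N] [Module R N] [Module.Finite R N],
    (∀ i < t, Subsingleton (Ext (ModuleCat.of R K) (ModuleCat.of R N) i)) →
    ∀ i < t, Subsingleton (Ext (ModuleCat.of R K) (ModuleCat.of R (N ⊗[R] P)) i) := by
  induction t with
  | zero => intros; omega
  | succ t ih =>
    intro N _ _ _ hdepth
    obtain ⟨x, hx, hreg⟩ := exists_isSMulRegular_of_ext_zero (hdepth 0 t.succ_pos)
    have hex := LinearMap.exact_lsmul_mkQ_smul_top N x
    have hsurj := Submodule.mkQ_surjective (Submodule.map (LinearMap.lsmul R N x) ⊤)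
    refine ext_subsingleton_of_regular_quotient hx (hreg.rTensor P) ?_
      (LinearMap.rTensor_surjective P hsurj)
      (ih _ (ext_regular_quotient_subsingleton hreg hex hsurj hdepth))
    have hT : LinearMap.rTensor P (LinearMap.lsmul R N x) = LinearMap.lsmul R (N ⊗[R] P) x :=
      LinearMap.rTensor_smul_action P N x
    exact hT ▸ rTensor_exact P hex hsurj

end DepthSemidualizing

/-! ### `Tor` and width of `Hom(C, I)` -/

section TorVanishing

open MonoidalCategory

variable {R : Type u} [CommRing R] {K : ModuleCat.{u} R}

/-- The functor sending a module `N` to the complex `P ⊗ N`, for a fixed complex `P`. -/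
noncomputable def tensorComplex (P : ChainComplex (ModuleCat.{u} R) ℕ) :
    ModuleCat.{u} R ⥤ ChainComplex (ModuleCat.{u} R) ℕ where
  obj N := (((tensoringRight (ModuleCat.{u} R)).obj N).mapHomologicalComplex _).obj P
  map f := (NatTrans.mapHomologicalComplex ((tensoringRight (ModuleCat.{u} R)).map f) _).app P

instance (P : ChainComplex (ModuleCat.{u} R) ℕ) : (tensorComplex P).PreservesZeroMorphisms where
  map_zero A B := by
    ext n : 1
    change P.X n ◁ (0 : A ⟶ B) = 0
    simp

lemma tensorComplex_shortExact (P : ChainComplex (ModuleCat.{u} R) ℕ)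
    [∀ n, Projective (P.X n)] {S : ShortComplex (ModuleCat.{u} R)} (hS : S.ShortExact) :
    (S.map (tensorComplex P)).ShortExact := by
  refine HomologicalComplex.shortExact_of_degreewise_shortExact _ fun n ↦ ?_
  have : Module.Projective R (P.X n) := (IsProjective.iff_projective _).2 inferInstance
  exact { exact := Module.Flat.lTensor_shortComplex_exact (P.X n) S hS.exact
          mono_f := (ModuleCat.mono_iff_injective _).2
            (Module.Flat.lTensor_preserves_injective_linearMap (M := P.X n) S.f.hom
              ((ModuleCat.mono_iff_injective _).1 hS.mono_f))
          epi_g := (ModuleCat.epi_iff_surjective _).2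
            (LinearMap.lTensor_surjective (P.X n)
              ((ModuleCat.epi_iff_surjective S.g).1 hS.epi_g)) }

/-- `Tor'` computed from a projective resolution of the first argument. -/
noncomputable def torIso (P : ProjectiveResolution K) (N : ModuleCat.{u} R) (i : ℕ) :
    ((Tor' (ModuleCat.{u} R) i).obj K).obj N ≅ ((tensorComplex P.complex).obj N).homology i :=
  P.isoLeftDerivedObj ((tensoringRight (ModuleCat.{u} R)).obj N) i

lemma CategoryTheory.ShortComplex.ShortExact.isZero_tor_X₁ {S : ShortComplex (ModuleCat.{u} R)}
    (hS : S.ShortExact) {i : ℕ} (h₂ : Limits.IsZero (((Tor' (ModuleCat.{u} R) i).obj K).obj S.X₂))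
    (h₃ : Limits.IsZero (((Tor' (ModuleCat.{u} R) (i + 1)).obj K).obj S.X₃)) :
    Limits.IsZero (((Tor' (ModuleCat.{u} R) i).obj K).obj S.X₁) := by
  let P := ProjectiveResolution.of K
  have hP := tensorComplex_shortExact P.complex hS
  exact .of_iso ((hP.homology_exact₁ (i + 1) i (by simp)).isZero_of_both_isZero
    (h₃.of_iso (torIso P _ _).symm) (h₂.of_iso (torIso P _ _).symm)) (torIso P _ _)

/-- Multiplication by `x` on the resolution lifts the zero map of `K`, so it is null-homotopic, and
it stays so after tensoring with `N`. -/
lemma homologyMap_tensorComplex_smul_eq_zero (P : ProjectiveResolution K) {x : R}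
    (hx : x ∈ Module.annihilator R K) (N : ModuleCat.{u} R) (i : ℕ) :
    HomologicalComplex.homologyMap ((tensorComplex P.complex).map (x • 𝟙 N)) i = 0 := by
  have h0 : (x • 𝟙 P.complex) ≫ P.π = 0 := by
    refine HomologicalComplex.to_single_hom_ext ?_
    let e : ((ChainComplex.single₀ (ModuleCat.{u} R)).obj K).X 0 ≅ K :=
      HomologicalComplex.singleObjXSelf (ComplexShape.down ℕ) 0 K
    have hK : x • 𝟙 K = 0 := by
      ext k
      exact Module.mem_annihilator.1 hx k
    calc ((x • 𝟙 P.complex) ≫ P.π).f 0 = x • P.π.f 0 := by simp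
      _ = (P.π.f 0 ≫ e.hom) ≫ (x • 𝟙 K) ≫ e.inv := by
        rw [Linear.smul_comp, Category.id_comp, Linear.comp_smul, Category.assoc, e.hom_inv_id,
          Category.comp_id]
      _ = 0 := by rw [hK, Limits.zero_comp, Limits.comp_zero]
  let h := (((tensoringRight (ModuleCat.{u} R)).obj N).mapHomotopy
    (ProjectiveResolution.liftHomotopyZero (x • 𝟙 P.complex) h0))
  have h1 : (tensorComplex P.complex).map (x • 𝟙 N) =
      (((tensoringRight (ModuleCat.{u} R)).obj N).mapHomologicalComplex _).map
        (x • 𝟙 P.complex) := by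
    ext n : 1
    change P.complex.X n ◁ (x • 𝟙 N) = (x • 𝟙 (P.complex.X n)) ▷ N
    simp
  exact (congrArg (HomologicalComplex.homologyMap · i) h1).trans
    ((h.homologyMap_eq i).trans (by simp; rfl))

section

variable {K A L : Type u} [AddCommGroup K] [Module R K] [AddCommGroup A] [Module R A]
  [AddCommGroup L] [Module R L] {x : R} {f : L →ₗ[R] A}

lemma isZero_tor_zero_of_smul_surjective (hx : x ∈ Module.annihilator R K)
    (hsurj : Function.Surjective (LinearMap.lsmul R A x)) :
    Limits.IsZero (((Tor' (ModuleCat.{u} R) 0).obj (ModuleCat.of R K)).obj (ModuleCat.of R A)) := by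
  refine Limits.IsZero.of_iso ?_
    (((tensoringRight (ModuleCat.{u} R)).obj (ModuleCat.of R A)).leftDerivedZeroIsoSelf.app
      (ModuleCat.of R K))
  have : Subsingleton (K ⊗[R] A) := by
    refine subsingleton_of_forall_eq 0 fun z ↦ ?_
    induction z with
    | zero => rfl
    | tmul k a =>
      obtain ⟨b, rfl⟩ := hsurj a
      rw [LinearMap.lsmul_apply, TensorProduct.tmul_smul, TensorProduct.smul_tmul',
        Module.mem_annihilator.1 hx k, TensorProduct.zero_tmul]
    | add y z hy hz => rw [hy, hz, add_zero]
  exact ModuleCat.isZero_of_subsingleton (ModuleCat.of R (K ⊗[R] A))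

/-- Dual of `ext_subsingleton_of_regular_quotient`: since `x` is zero on `Tor`, the connecting map
embeds `Tor_(i+1)(K, A)` in `Tor_i(K, L)`. -/
lemma isZero_tor_of_kernel_smul (hx : x ∈ Module.annihilator R K)
    (hf : Function.Injective f) (hex : Function.Exact f (LinearMap.lsmul R A x))
    (hsurj : Function.Surjective (LinearMap.lsmul R A x)) {t : ℕ}
    (h : ∀ i < t, Limits.IsZero
      (((Tor' (ModuleCat.{u} R) i).obj (ModuleCat.of R K)).obj (ModuleCat.of R L))) :
    ∀ i < t + 1, Limits.IsZero
      (((Tor' (ModuleCat.{u} R) i).obj (ModuleCat.of R K)).obj (ModuleCat.of R A)) := by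
  intro i hi
  cases i with
  | zero => exact isZero_tor_zero_of_smul_surjective hx hsurj
  | succ i =>
    let P := ProjectiveResolution.of (ModuleCat.of R K)
    have hP := tensorComplex_shortExact P.complex
      (ModuleCat.shortExact_of_linearMap hf hex hsurj)
    exact .of_iso ((hP.homology_exact₃ (i + 1) i (by simp)).isZero_of_both_zeros
      (homologyMap_tensorComplex_smul_eq_zero P hx _ _)
      (((h i (by omega)).of_iso (torIso P _ _).symm).eq_zero_of_tgt _)) (torIso P _ _)

/-- If `I` is injective, then the width of `Hom(N, I)` is at least the depth of the finitely
generated module `N`. -/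
theorem isZero_tor_hom_injective [IsNoetherianRing R] [Module.Finite R K] (I : Type u)
    [AddCommGroup I] [Module R I] [Module.Injective R I] (t : ℕ) :
    ∀ (N : Type u) [AddCommGroup N] [Module R N] [Module.Finite R N],
    (∀ i < t, Subsingleton (Abelian.Ext (ModuleCat.of R K) (ModuleCat.of R N) i)) →
    ∀ i < t, Limits.IsZero
      (((Tor' (ModuleCat.{u} R) i).obj (ModuleCat.of R K)).obj (ModuleCat.of R (N →ₗ[R] I))) := by
  induction t with
  | zero => intros; omega
  | succ t ih =>
    intro N _ _ _ hdepth
    obtain ⟨x, hx, hreg⟩ := exists_isSMulRegular_of_ext_zero (hdepth 0 t.succ_pos)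
    have hex := LinearMap.exact_lsmul_mkQ_smul_top N x
    have hsurj := Submodule.mkQ_surjective (Submodule.map (LinearMap.lsmul R N x) ⊤)
    have hT : LinearMap.lcomp R I (LinearMap.lsmul R N x) = LinearMap.lsmul R (N →ₗ[R] I) x := by
      ext φ n
      simp
    -- Dualizing into `I` makes `x` surjective on `Hom(N, I)` with kernel `Hom(N/xN, I)`.
    refine isZero_tor_of_kernel_smul hx (LinearMap.lcomp_injective_of_surjective _ hsurj)
      (hT ▸ LinearMap.exact_lcomp_of_exact_of_surjective I hex hsurj) (hT ▸ fun φ ↦ ?_)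
      (ih _ (ext_regular_quotient_subsingleton hreg hex hsurj hdepth))
    exact Module.Injective.extension_property R I N N (LinearMap.lsmul R N x) hreg φ

end

end TorVanishing

/-! ### Dimension shifting along (co)resolutions -/

section Resolutions

open Limits IsLocalRing

variable {R : Type u} [CommRing R]

/-- Opcycles play the role of syzygies: in degree `0` they are `H₀`, and each short exact sequence
shifts by one degree. -/
lemma ChainComplex.shortExact_opcycles (X : ChainComplex (ModuleCat.{u} R) ℕ) (j : ℕ)
    (h : IsZero (X.homology (j + 1))) :
    ∃ S : ShortComplex (ModuleCat.{u} R), S.ShortExact ∧ S.X₁ = X.opcycles (j + 1) ∧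
      S.X₂ = X.X j ∧ S.X₃ = X.opcycles j := by
  have hz : X.fromOpcycles (j + 1) j ≫ X.pOpcycles j = 0 := by
    rw [← cancel_epi (X.pOpcycles (j + 1))]
    simp
  let S' : ShortComplex (ModuleCat.{u} R) := ⟨X.d (j + 1) j, X.pOpcycles j, X.d_pOpcycles _ _⟩
  let S : ShortComplex (ModuleCat.{u} R) := ⟨X.fromOpcycles (j + 1) j, X.pOpcycles j, hz⟩
  have hS' : S'.Exact := S'.exact_of_g_is_cokernel (X.opcyclesIsCokernel (j + 1) j (by simp))
  let φ : S' ⟶ S := { τ₁ := X.pOpcycles (j + 1), τ₂ := 𝟙 _, τ₃ := 𝟙 _ }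
  have : Epi φ.τ₁ := inferInstanceAs (Epi (X.pOpcycles (j + 1)))
  have : IsIso φ.τ₂ := inferInstanceAs (IsIso (𝟙 (X.X j)))
  have : Mono φ.τ₃ := inferInstanceAs (Mono (𝟙 (X.opcycles j)))
  refine ⟨S, ?_, rfl, rfl, rfl⟩
  exact
    { exact := (ShortComplex.exact_iff_of_epi_of_isIso_of_mono φ).1 hS'
      mono_f := Preadditive.mono_of_isZero_kernel' _
        (X.homologyIsKernel (j + 1) j (by simp)) h
      epi_g := inferInstanceAs (Epi (X.pOpcycles j)) }

lemma CochainComplex.shortExact_cycles (X : CochainComplex (ModuleCat.{u} R) ℕ) (j : ℕ)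
    (h : IsZero (X.homology (j + 1))) :
    ∃ S : ShortComplex (ModuleCat.{u} R), S.ShortExact ∧ S.X₁ = X.cycles j ∧
      S.X₂ = X.X j ∧ S.X₃ = X.cycles (j + 1) := by
  have hz : X.iCycles j ≫ X.toCycles j (j + 1) = 0 := by
    rw [← cancel_mono (X.iCycles (j + 1))]
    simp
  let S' : ShortComplex (ModuleCat.{u} R) := ⟨X.iCycles j, X.d j (j + 1), X.iCycles_d _ _⟩
  let S : ShortComplex (ModuleCat.{u} R) := ⟨X.iCycles j, X.toCycles j (j + 1), hz⟩
  have hS' : S'.Exact := S'.exact_of_f_is_kernel (X.cyclesIsKernel j (j + 1) (by simp))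
  let φ : S ⟶ S' := { τ₁ := 𝟙 _, τ₂ := 𝟙 _, τ₃ := X.iCycles (j + 1) }
  have : Epi φ.τ₁ := inferInstanceAs (Epi (𝟙 (X.cycles j)))
  have : IsIso φ.τ₂ := inferInstanceAs (IsIso (𝟙 (X.X j)))
  have : Mono φ.τ₃ := inferInstanceAs (Mono (X.iCycles (j + 1)))
  refine ⟨S, ?_, rfl, rfl, rfl⟩
  exact
    { exact := (ShortComplex.exact_iff_of_epi_of_isIso_of_mono φ).2 hS'
      mono_f := inferInstanceAs (Mono (X.iCycles j))
      epi_g := Preadditive.epi_of_isZero_cokernel' _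
        (X.homologyIsCokernel j (j + 1) (by simp)) h }

lemma IsClassResolution.ext_subsingleton {𝒳 : ObjectProperty (ModuleCat.{u} R)}
    {M K : ModuleCat.{u} R} {X : ChainComplex (ModuleCat.{u} R) ℕ} (hX : IsClassResolution 𝒳 M X)
    {n t : ℕ} (hn : ∀ j, n ≤ j → Subsingleton (X.X j))
    (ht : ∀ A, 𝒳 A → ∀ i < t, Subsingleton (Abelian.Ext K A i)) {i : ℕ} (hi : i + n ≤ t) :
    Subsingleton (Abelian.Ext K M i) := by
  have hzero (j : ℕ) (hj : n ≤ j) (i : ℕ) : Subsingleton (Abelian.Ext K (X.opcycles j) i) := by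
    have := hn j hj
    have hZ : IsZero (X.opcycles j) :=
      (ModuleCat.isZero_of_subsingleton (X.X j)).of_epi (X.pOpcycles j)
    refine subsingleton_of_forall_eq 0 fun y ↦ ?_
    rw [← Abelian.Ext.comp_mk₀_id y, hZ.eq_zero_of_src (𝟙 _), Abelian.Ext.mk₀_zero,
      Abelian.Ext.comp_zero]
  -- Descending induction on `j`, with `m` bounding the distance to `n`. The bound on `i` is stable
  -- under raising `i` and `j` together, and gives `i < t` when `j < n`.
  have key (m : ℕ) : ∀ j, n ≤ j + m → ∀ i, i + n ≤ t + j →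
      Subsingleton (Abelian.Ext K (X.opcycles j) i) := by
    induction m with
    | zero => exact fun j hj i _ ↦ hzero j hj i
    | succ m ih =>
      intro j hj i hi
      by_cases hjn : n ≤ j
      · exact hzero j hjn i
      · obtain ⟨S, hS, h₁, h₂, h₃⟩ :=
          ChainComplex.shortExact_opcycles X j (hX.homology_pos (j + 1) (by omega))
        rw [← h₃]
        refine hS.subsingleton_ext_X₃ ?_ ?_
        · rw [h₂]
          exact ht _ (hX.mem j) i (by omega)
        · rw [h₁]
          exact ih (j + 1) (by omega) (i + 1) (by omega)
  obtain ⟨e⟩ := hX.homology_zero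
  exact Abelian.Ext.subsingleton_of_iso (X.isoHomologyι₀.symm ≪≫ e)
    (key n 0 (by omega) i (by omega))

lemma IsClassCoresolution.isZero_tor {𝒳 : ObjectProperty (ModuleCat.{u} R)}
    {M K : ModuleCat.{u} R} {X : CochainComplex (ModuleCat.{u} R) ℕ}
    (hX : IsClassCoresolution 𝒳 M X)
    {n t : ℕ} (hn : ∀ j, n ≤ j → Subsingleton (X.X j))
    (ht : ∀ A, 𝒳 A → ∀ i < t, IsZero (((Tor' (ModuleCat.{u} R) i).obj K).obj A))
    {i : ℕ} (hi : i + n ≤ t) :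
    IsZero (((Tor' (ModuleCat.{u} R) i).obj K).obj M) := by
  have hzero (j : ℕ) (hj : n ≤ j) (i : ℕ) :
      IsZero (((Tor' (ModuleCat.{u} R) i).obj K).obj (X.cycles j)) := by
    have := hn j hj
    have hZ : IsZero (X.cycles j) :=
      (ModuleCat.isZero_of_subsingleton (X.X j)).of_mono (X.iCycles j)
    have hP : IsZero ((tensorComplex (ProjectiveResolution.of K).complex).obj (X.cycles j)) :=
      Functor.map_isZero _ hZ
    exact ((HomologicalComplex.homologyFunctor _ _ i).map_isZero hP).of_iso (torIso _ _ _)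
  have key (m : ℕ) : ∀ j, n ≤ j + m → ∀ i, i + n ≤ t + j →
      IsZero (((Tor' (ModuleCat.{u} R) i).obj K).obj (X.cycles j)) := by
    induction m with
    | zero => exact fun j hj i _ ↦ hzero j hj i
    | succ m ih =>
      intro j hj i hi
      by_cases hjn : n ≤ j
      · exact hzero j hjn i
      · obtain ⟨S, hS, h₁, h₂, h₃⟩ :=
          CochainComplex.shortExact_cycles X j (hX.homology_pos (j + 1) (by omega))
        rw [← h₁]
        refine hS.isZero_tor_X₁ ?_ ?_
        · rw [h₂]
          exact ht _ (hX.mem j) i (by omega)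
        · rw [h₃]
          exact ih (j + 1) (by omega) (i + 1) (by omega)
  obtain ⟨e⟩ := hX.homology_zero
  exact (key n 0 (by omega) i (by omega)).of_iso
    (((Tor' (ModuleCat.{u} R) i).obj K).mapIso (X.isoHomologyπ₀ ≪≫ e)).symm

lemma exists_isClassResolution_of_classPd_lt {𝒳 : ObjectProperty (ModuleCat.{u} R)}
    {M : ModuleCat.{u} R} {n : ℕ} (h : classPd 𝒳 M < n) :
    ∃ X, IsClassResolution 𝒳 M X ∧ ∀ j, n ≤ j → Subsingleton (X.X j) := by
  simp only [classPd, iInf_lt_iff] at h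
  obtain ⟨X, hX, hlt⟩ := h
  refine ⟨X, hX, fun j hj ↦ not_nontrivial_iff_subsingleton.1 fun hnt ↦ ?_⟩
  have h1 : (j : WithBot ℕ∞) < n := (le_iSup₂_of_le j hnt le_rfl).trans_lt hlt
  exact absurd (by exact_mod_cast h1) hj.not_gt

lemma exists_isClassCoresolution_of_classId_lt {𝒳 : ObjectProperty (ModuleCat.{u} R)}
    {M : ModuleCat.{u} R} {n : ℕ} (h : classId 𝒳 M < n) :
    ∃ X, IsClassCoresolution 𝒳 M X ∧ ∀ j, n ≤ j → Subsingleton (X.X j) := by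
  simp only [classId, iInf_lt_iff] at h
  obtain ⟨X, hX, hlt⟩ := h
  refine ⟨X, hX, fun j hj ↦ not_nontrivial_iff_subsingleton.1 fun hnt ↦ ?_⟩
  have h1 : (j : WithBot ℕ∞) < n := (le_iSup₂_of_le j hnt le_rfl).trans_lt hlt
  exact absurd (by exact_mod_cast h1) hj.not_gt

/-- The value `⊥` would require a resolution by zero modules. It must be excluded, as adding `⊥`
would collapse the right-hand side. -/
lemma classPd_ne_bot (𝒳 : ObjectProperty (ModuleCat.{u} R)) (M : ModuleCat.{u} R) [Nontrivial M] :
    classPd 𝒳 M ≠ ⊥ := by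
  intro h
  obtain ⟨X, hX, h0⟩ := exists_isClassResolution_of_classPd_lt (n := 0) (𝒳 := 𝒳) (M := M)
    (h ▸ WithBot.bot_lt_coe _)
  obtain ⟨e⟩ := hX.homology_zero
  have := h0 0 le_rfl
  have hZ : IsZero (X.opcycles 0) :=
    (ModuleCat.isZero_of_subsingleton (X.X 0)).of_epi (X.pOpcycles 0)
  exact not_subsingleton M
    (ModuleCat.subsingleton_of_isZero (hZ.of_iso (X.isoHomologyι₀.symm ≪≫ e).symm))

lemma classId_ne_bot (𝒳 : ObjectProperty (ModuleCat.{u} R)) (M : ModuleCat.{u} R) [Nontrivial M] :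
    classId 𝒳 M ≠ ⊥ := by
  intro h
  obtain ⟨X, hX, h0⟩ := exists_isClassCoresolution_of_classId_lt (n := 0) (𝒳 := 𝒳) (M := M)
    (h ▸ WithBot.bot_lt_coe _)
  obtain ⟨e⟩ := hX.homology_zero
  have := h0 0 le_rfl
  have hZ : IsZero (X.cycles 0) :=
    (ModuleCat.isZero_of_subsingleton (X.X 0)).of_mono (X.iCycles 0)
  exact not_subsingleton M
    (ModuleCat.subsingleton_of_isZero (hZ.of_iso (X.isoHomologyπ₀ ≪≫ e).symm))

lemma WithBot.coe_iInf_le_add {P Q : ℕ → Prop} {c : WithBot ℕ∞} (hc : c ≠ ⊥)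
    (h : ∀ n t : ℕ, c < (n + 1 : ℕ) → (∀ i < t, ¬ P i) → ∀ i, i + (n + 1) ≤ t → ¬ Q i) :
    ((⨅ (i : ℕ) (_ : P i), (i : ℕ∞) : ℕ∞) : WithBot ℕ∞) ≤
      ((⨅ (i : ℕ) (_ : Q i), (i : ℕ∞) : ℕ∞) : WithBot ℕ∞) + c := by
  lift c to ℕ∞ using hc
  induction c with
  | top =>
    rw [← WithBot.coe_add, add_top]
    exact WithBot.coe_le_coe.2 le_top
  | coe n =>
    rw [← WithBot.coe_add, WithBot.coe_le_coe, ENat.iInf_add]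
    refine le_iInf fun i ↦ ?_
    by_cases hi : Q i
    swap
    · simp [hi]
    simp only [hi, iInf_pos]
    by_contra! hlt
    have hlt' : ((i + n + 1 : ℕ) : ℕ∞) ≤ ⨅ (i : ℕ) (_ : P i), (i : ℕ∞) := by
      exact_mod_cast Order.add_one_le_of_lt hlt
    -- A failure at `i` means `P` vanishes in all degrees up to `i + n`, so `t = i + n + 1` is
    -- allowed; `c < n + 1` encodes `c ≤ n`.
    refine h n (i + n + 1) ?_ (fun k hk hPk ↦ ?_) i (by omega) hi
    · exact WithBot.coe_lt_coe.2 (ENat.natCast_lt_natCast.2 n.lt_succ_self)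
    · have := hlt'.trans (iInf₂_le k hPk)
      exact absurd (ENat.natCast_le_natCast.1 this) (by omega)

end Resolutions

theorem theorem3p15 (R : Type u) [CommRing R] [IsNoetherianRing R] [IsLocalRing R]
    (C : Type u) [AddCommGroup C] [Module R C] (hC : IsSemidualizing R C)
    (M : Type u) [AddCommGroup M] [Module R M] [Nontrivial M] :
    (moduleDepth R R : WithBot ℕ∞) ≤ (moduleDepth R M : WithBot ℕ∞) + cPd R C M ∧
      (moduleDepth R R : WithBot ℕ∞) ≤ (moduleWidth R M : WithBot ℕ∞) + cId R C M := by
  have := hC.finite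
  constructor
  · refine WithBot.coe_iInf_le_add (classPd_ne_bot _ _) fun n t hlt hR i hi ↦ ?_
    simp only [not_nontrivial_iff_subsingleton] at hR ⊢
    obtain ⟨X, hX, hn⟩ := exists_isClassResolution_of_classPd_lt hlt
    refine hX.ext_subsingleton hn ?_ hi
    rintro A ⟨P, hP, ⟨e⟩⟩ j hj
    exact Abelian.Ext.subsingleton_of_iso e.toModuleIso.symm
      (ext_subsingleton_tensor_flat _ P t C (hC.ext_residue_subsingleton hR) j hj)
  · refine WithBot.coe_iInf_le_add (classId_ne_bot _ _) fun n t hlt hR i hi ↦ ?_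
    simp only [not_nontrivial_iff_subsingleton] at hR
    rw [not_not]
    obtain ⟨X, hX, hn⟩ := exists_isClassCoresolution_of_classId_lt hlt
    refine hX.isZero_tor hn ?_ hi
    rintro A ⟨I, hI, ⟨e⟩⟩ j hj
    exact (isZero_tor_hom_injective I t C (hC.ext_residue_subsingleton hR) j hj).of_iso
      (((Tor' (ModuleCat.{u} R) j).obj _).mapIso e.toModuleIso)
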